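/- For a complex number $\tau$ with positive imaginary part and $s\in\mathbb{R}$, write $q^{s}:=e^{2\pi i s\tau}$, and let $$\lambda(\tau):=16\,q^{1/2}\prod_{n=1}^{\infty}\frac{(1+q^{n})^{8}}{(1+q^{n-\frac12})^{8}}$$ be the elliptic lambda function. For real $d>0$ put $\sqrt{-d}:=i\sqrt{d}$. (1) If $d>c>0$ are real numbers, then $\lambda(\sqrt{-d})$ and $\lambda(\sqrt{-c})$ are real and $$0<\lambda(\sqrt{-d})<\lambda(\sqrt{-c})<1.$$ (2) For real $d>0$ put $$\alpha_d:=\frac14\left(\sqrt{\frac{1-\lambda(\sqrt{-d})}{\lambda(\sqrt{-d})}}-\sqrt{\frac{\lambda(\sqrt{-d})}{1-\lambda(\sqrt{-d})}}\right),$$ with principal square roots. Then, for every real $d>0$, $\alpha_d$ is real and $$\lambda\!\left(\frac{\sqrt{-d}-1}{\sqrt{-d}+1}\right)=\frac12+i\,\alpha_d ,$$ and $d\mapsto\alpha_d$ is strictly increasing on $(0,\infty)$. -/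

import Mathlib

/-- `√(-d) = i √d`, the square root in the upper half plane, for real `d > 0`. -/
noncomputable def sqrtNeg (d : ℝ) : ℂ := Complex.I * (Real.sqrt d : ℂ)

/-- The real power `q ^ s = exp (2 π i s τ)` of `q = exp (2 π i τ)`. -/
noncomputable def qPow (s : ℝ) (τ : ℂ) : ℂ :=
  Complex.exp (2 * (Real.pi : ℂ) * Complex.I * (s : ℂ) * τ)

/-- The `n`-th factor `(1 + q ^ n) ^ 8 / (1 + q ^ (n - 1/2)) ^ 8` of the product below. -/
noncomputable def lambdaFactor (n : ℕ) (τ : ℂ) : ℂ :=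
  (1 + qPow n τ) ^ 8 / (1 + qPow (n - 1 / 2) τ) ^ 8

/-- The elliptic lambda function
`λ(τ) = 16 q ^ (1/2) ∏_{n ≥ 1} (1 + q ^ n) ^ 8 / (1 + q ^ (n - 1/2)) ^ 8`, for `0 < Im τ`
(the index `n` of the Lean product starts at `0`). -/
noncomputable def ellipticLambda (τ : ℂ) : ℂ :=
  16 * qPow (1 / 2) τ * ∏' n : ℕ, lambdaFactor (n + 1) τ

/-- `α_d = (√((1 - λ) / λ) - √(λ / (1 - λ))) / 4` with `λ = λ(√(-d))`, as a complex number; the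
square roots are principal complex square roots. -/
noncomputable def alpha (d : ℝ) : ℂ :=
  1 / 4 *
    (Complex.sqrt ((1 - ellipticLambda (sqrtNeg d)) / ellipticLambda (sqrtNeg d)) -
      Complex.sqrt (ellipticLambda (sqrtNeg d) / (1 - ellipticLambda (sqrtNeg d))))

theorem norm_qPow (s : ℝ) (τ : ℂ) : ‖qPow s τ‖ = Real.exp (-(2 * Real.pi * s * τ.im)) := by
  rw [qPow, Complex.norm_exp]
  congr 1
  simp [Complex.mul_re, Complex.mul_im]

theorem norm_qPow_lt_one {s : ℝ} {τ : ℂ} (hs : 0 < s) (hτ : 0 < τ.im) : ‖qPow s τ‖ < 1 := by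
  rw [norm_qPow, Real.exp_lt_one_iff, neg_lt_zero]
  positivity

theorem one_add_qPow_ne_zero {s : ℝ} {τ : ℂ} (hs : 0 < s) (hτ : 0 < τ.im) :
    1 + qPow s τ ≠ 0 := by
  intro h
  have h1 : qPow s τ = -1 := by linear_combination h
  have h2 := norm_qPow_lt_one hs hτ
  simp [h1] at h2

/-- The series `∑ q ^ (n + s)` converges absolutely in the upper half plane. -/
theorem summable_norm_qPow (s : ℝ) {τ : ℂ} (hτ : 0 < τ.im) :
    Summable fun n : ℕ => ‖qPow (n + s) τ‖ := by
  have h : (fun n : ℕ => ‖qPow (n + s) τ‖) =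
      fun n : ℕ => ‖qPow s τ‖ * ‖qPow 1 τ‖ ^ n := by
    funext n
    rw [norm_qPow, norm_qPow, norm_qPow, ← Real.exp_nat_mul, ← Real.exp_add]
    congr 1
    ring
  rw [h]
  exact (summable_geometric_of_lt_one (norm_nonneg _) (norm_qPow_lt_one one_pos hτ)).mul_left _

/-- The product defining the elliptic lambda function converges in the upper half plane. -/
theorem multipliable_lambdaFactor {τ : ℂ} (hτ : 0 < τ.im) :
    Multipliable fun n : ℕ => lambdaFactor (n + 1) τ := by
  have hN : Multipliable fun n : ℕ => 1 + qPow (n + 1) τ :=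
    multipliable_one_add_of_summable (summable_norm_qPow 1 hτ)
  have hD : Multipliable fun n : ℕ => 1 + qPow (n + 1 / 2) τ :=
    multipliable_one_add_of_summable (summable_norm_qPow (1 / 2) hτ)
  have hD0 : ∏' n : ℕ, (1 + qPow (n + 1 / 2) τ) ≠ 0 :=
    tprod_one_add_ne_zero_of_summable
      (fun n => one_add_qPow_ne_zero (by positivity) hτ) (summable_norm_qPow (1 / 2) hτ)
  have h := ((hN.hasProd.div₀ hD.hasProd hD0).pow 8).multipliable
  refine h.congr fun n => ?_
  rw [lambdaFactor, div_pow]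
  push_cast
  ring_nf

theorem sqrtNeg_im_pos {d : ℝ} (hd : 0 < d) : 0 < (sqrtNeg d).im := by
  simpa [sqrtNeg] using hd

theorem sqrtNeg_moebius_im_pos {d : ℝ} (hd : 0 < d) :
    0 < ((sqrtNeg d - 1) / (sqrtNeg d + 1)).im := by
  have hs : 0 < Real.sqrt d := Real.sqrt_pos.2 hd
  have h : ((sqrtNeg d - 1) / (sqrtNeg d + 1)).im = 2 * Real.sqrt d / (1 + d) := by
    rw [Complex.div_im]
    simp [sqrtNeg, Complex.normSq_apply, Real.mul_self_sqrt hd.le]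
    ring
  rw [h]
  positivity

open Complex Filter Topology

/-! Everything is read off from theta constants. The Jacobi triple product turns the product for λ
into θ₂⁴/θ₃⁴ (`ellipticLambda_eq`) and shows that θ₃ has no zeros in the upper half plane.

On the imaginary axis it also writes k'(d) = θ₄²/θ₃² as the fourth power of ∏ (1 - r^(2n+1))/(1 +
r^(2n+1)) with r = exp(-π√d), which visibly increases with d. The inversion τ ↦ -1/τ gives θ₂²/θ₃² =
k'(1/d), so λ(√-d) = k'(1/d)², and Jacobi's identity becomes k'(1/d)² + k'(d)² = 1. Hence λ
decreases and lies in (0, 1), and 4α = k'(d)/k'(1/d) - k'(1/d)/k'(d) increases.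

For the Möbius value, (τ - 1)/(τ + 1) = -1/w + 1 with w = (τ + 1)/2. Inversion and translation
reduce λ there to theta constants at w, duplication moves them to 2w = τ + 1, and one more
translation moves them to τ (`ellipticLambda_moebius`). -/

/-! ### Finite q-binomial theorem and finite triple product -/

/-- The finite product `(1 - q) (1 - q ^ 2) ⋯ (1 - q ^ n)`. -/
noncomputable def qFactorial (q : ℂ) (n : ℕ) : ℂ := ∏ k ∈ Finset.range n, (1 - q ^ (k + 1))

/-- The coefficient of `x ^ m` in `∏ k < N, (1 + x q ^ k)`. -/
noncomputable def qBinomialCoeff (q : ℂ) : ℕ → ℕ → ℂ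
  | _, 0 => 1
  | 0, _ + 1 => 0
  | N + 1, m + 1 => qBinomialCoeff q N (m + 1) + q ^ N * qBinomialCoeff q N m

theorem qBinomialCoeff_eq_zero (q : ℂ) {N m : ℕ} (h : N < m) : qBinomialCoeff q N m = 0 := by
  induction N generalizing m with
  | zero =>
    obtain ⟨m, rfl⟩ := Nat.exists_eq_add_of_lt h
    simp [qBinomialCoeff]
  | succ N ih =>
    obtain _ | m := m
    · omega
    · rw [qBinomialCoeff, ih (by omega), ih (by omega)]
      simp

theorem prod_one_add_mul_pow (q x : ℂ) (N : ℕ) :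
    ∏ k ∈ Finset.range N, (1 + x * q ^ k) =
      ∑ m ∈ Finset.range (N + 1), qBinomialCoeff q N m * x ^ m := by
  induction N with
  | zero => simp [qBinomialCoeff]
  | succ N ih =>
    have h1 := Finset.sum_range_succ (fun m => qBinomialCoeff q N m * x ^ m) (N + 1)
    rw [Finset.sum_range_succ', qBinomialCoeff_eq_zero q (Nat.lt_succ_self N)] at h1
    have h2 : ∑ m ∈ Finset.range (N + 1), q ^ N * qBinomialCoeff q N m * x ^ (m + 1) =
        (∑ m ∈ Finset.range (N + 1), qBinomialCoeff q N m * x ^ m) * (x * q ^ N) := by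
      rw [Finset.sum_mul]
      exact Finset.sum_congr rfl fun m _ => by ring
    have h0 : qBinomialCoeff q N 0 = 1 := by cases N <;> rfl
    rw [Finset.prod_range_succ, ih, Finset.sum_range_succ' _ (N + 1)]
    simp only [qBinomialCoeff, add_mul, Finset.sum_add_distrib]
    rw [h0] at h1
    linear_combination -h1 - h2

theorem qFactorial_succ (q : ℂ) (n : ℕ) :
    qFactorial q (n + 1) = qFactorial q n * (1 - q ^ (n + 1)) :=
  Finset.prod_range_succ _ _

/-- Closed form of the Gaussian binomial coefficient, stated without division so that the Pascal
recursion proves it for every `q`. -/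
theorem qBinomialCoeff_mul (q : ℂ) (m b : ℕ) :
    qBinomialCoeff q (m + b) m * qFactorial q m * qFactorial q b =
      qFactorial q (m + b) * q ^ m.choose 2 := by
  obtain ⟨N, hN⟩ : ∃ N, N = m + b := ⟨_, rfl⟩
  induction N generalizing m b with
  | zero =>
    obtain rfl : m = 0 := by omega
    obtain rfl : b = 0 := by omega
    simp [qBinomialCoeff, qFactorial]
  | succ N ih =>
    obtain _ | m := m
    · have h0 : qBinomialCoeff q b 0 = 1 := by cases b <;> rfl
      simp [h0, qFactorial]
    have hc : (m + 1).choose 2 = m + m.choose 2 := by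
      rw [Nat.choose_succ_succ' m 1, Nat.choose_one_right]
    rw [← hN, qBinomialCoeff, hc, pow_add, qFactorial_succ, qFactorial_succ]
    -- For `b = 0` one term of the recursion lies above the diagonal and vanishes.
    obtain _ | b := b
    · have h := ih m 0 (by omega)
      obtain rfl : N = m := by omega
      rw [qBinomialCoeff_eq_zero q (Nat.lt_succ_self N)]
      simp only [add_zero] at h
      linear_combination q ^ N * (1 - q ^ (N + 1)) * h
    · have h1 := ih (m + 1) b (by omega)
      have h2 := ih m (b + 1) (by omega)
      rw [show m + 1 + b = N by omega, hc, pow_add, qFactorial_succ] at h1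
      rw [show m + (b + 1) = N by omega, qFactorial_succ] at h2
      rw [qFactorial_succ]
      obtain rfl : N = m + b + 1 := by omega
      linear_combination (1 - q ^ (b + 1)) * h1 + q ^ (m + b + 1) * (1 - q ^ (m + 1)) * h2

theorem qFactorial_ne_zero {q : ℂ} (hq : ‖q‖ < 1) (n : ℕ) : qFactorial q n ≠ 0 := by
  refine Finset.prod_ne_zero_iff.2 fun k _ h => ?_
  have h1 : ‖q ^ (k + 1)‖ < 1 := by
    rw [norm_pow]; exact pow_lt_one₀ (norm_nonneg _) hq (by omega)
  rw [← sub_eq_zero.1 h] at h1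
  simp at h1

/-- The finite form of the Jacobi triple product. -/
theorem prod_one_add_mul_one_add_inv {w Q : ℂ} (hw : w ≠ 0) (hQ : Q ≠ 0) (hQ1 : ‖Q‖ < 1) (n : ℕ) :
    ∏ i ∈ Finset.range n, ((1 + w * Q ^ (2 * i + 1)) * (1 + w⁻¹ * Q ^ (2 * i + 1))) =
      ∑ m ∈ Finset.range (n + n + 1),
        qFactorial (Q ^ 2) (n + n) / (qFactorial (Q ^ 2) m * qFactorial (Q ^ 2) (n + n - m)) *
          (w ^ ((m : ℤ) - n) * Q ^ (((m : ℤ) - n) ^ 2)) := by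
  have hq : ‖Q ^ 2‖ < 1 := by rw [norm_pow]; exact pow_lt_one₀ (norm_nonneg _) hQ1 (by omega)
  -- With this choice of `x` the exponents of `Q` run through the odd numbers from 1 - 2n to 2n - 1.
  -- Pulling the monomial out of each factor with negative exponent leaves the factors in `w⁻¹`.
  have key := prod_one_add_mul_pow (Q ^ 2) (w * Q ^ (1 - 2 * (n : ℤ))) (n + n)
  have h1 : ∏ k ∈ Finset.range (n + n), (1 + w * Q ^ (1 - 2 * (n : ℤ)) * (Q ^ 2) ^ k) =
      w ^ n * Q ^ (-(n : ℤ) ^ 2) *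
      ∏ i ∈ Finset.range n, ((1 + w * Q ^ (2 * i + 1)) * (1 + w⁻¹ * Q ^ (2 * i + 1))) := by
    rw [Finset.prod_range_add, ← Finset.prod_range_reflect, Finset.prod_mul_distrib]
    have ha : ∀ i ∈ Finset.range n,
        1 + w * Q ^ (1 - 2 * (n : ℤ)) * (Q ^ 2) ^ (n - 1 - i) =
          w * Q ^ (-(2 * (i : ℤ) + 1)) * (1 + w⁻¹ * Q ^ (2 * i + 1)) := by
      intro i hi
      have hi' := Finset.mem_range.1 hi
      rw [← pow_mul, ← zpow_natCast Q (2 * (n - 1 - i)), ← zpow_natCast Q (2 * i + 1), mul_assoc,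
        ← zpow_add₀ hQ, mul_add, mul_one,
        show w * Q ^ (-(2 * (i : ℤ) + 1)) * (w⁻¹ * Q ^ ((2 * i + 1 : ℕ) : ℤ)) =
          (w * w⁻¹) * (Q ^ (-(2 * (i : ℤ) + 1)) * Q ^ ((2 * i + 1 : ℕ) : ℤ)) by ring,
        ← zpow_add₀ hQ, mul_inv_cancel₀ hw, add_comm]
      congr 2
      · congr 1
        push_cast [Nat.sub_sub, Nat.cast_sub (show 1 + i ≤ n by omega)]
        ring
      · simp
    have hb : ∀ i ∈ Finset.range n,
        1 + w * Q ^ (1 - 2 * (n : ℤ)) * (Q ^ 2) ^ (n + i) = 1 + w * Q ^ (2 * i + 1) := by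
      intro i _
      rw [← pow_mul, ← zpow_natCast Q (2 * (n + i)), ← zpow_natCast Q (2 * i + 1), mul_assoc,
        ← zpow_add₀ hQ]
      congr 3
      push_cast
      ring
    rw [Finset.prod_congr rfl ha, Finset.prod_congr rfl hb, Finset.prod_mul_distrib]
    have hc : ∏ i ∈ Finset.range n, (w * Q ^ (-(2 * (i : ℤ) + 1))) =
        w ^ n * Q ^ (-(n : ℤ) ^ 2) := by
      clear key ha hb
      induction n with
      | zero => simp
      | succ n ih =>
        rw [Finset.prod_range_succ, ih,
          show -((n + 1 : ℕ) : ℤ) ^ 2 = -(n : ℤ) ^ 2 + -(2 * (n : ℤ) + 1) by push_cast; ring,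
          zpow_add₀ hQ]
        ring
    rw [hc]
    ring
  rw [h1] at key
  have hu : w ^ n * Q ^ (-(n : ℤ) ^ 2) ≠ 0 := by positivity
  refine mul_left_cancel₀ hu (key.trans ?_)
  rw [Finset.mul_sum]
  refine Finset.sum_congr rfl fun m hm => ?_
  have hm' : m ≤ n + n := Nat.lt_succ_iff.1 (Finset.mem_range.1 hm)
  have hcoef := qBinomialCoeff_mul (Q ^ 2) m (n + n - m)
  rw [Nat.add_sub_cancel' hm'] at hcoef
  have hcoef' : qBinomialCoeff (Q ^ 2) (n + n) m =
      qFactorial (Q ^ 2) (n + n) / (qFactorial (Q ^ 2) m * qFactorial (Q ^ 2) (n + n - m)) *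
        (Q ^ 2) ^ m.choose 2 := by
    have := qFactorial_ne_zero hq m
    have := qFactorial_ne_zero hq (n + n - m)
    field_simp
    linear_combination hcoef
  rw [hcoef', zpow_sub₀ hw, mul_pow, ← pow_mul, zpow_natCast, zpow_natCast]
  have h2 : 2 * m.choose 2 = m * m - m := by
    rw [Nat.choose_two_right, Nat.mul_div_cancel' (Nat.even_mul_pred_self m).two_dvd,
      Nat.mul_sub_one]
  have h3 : Q ^ (2 * m.choose 2) * (Q ^ (1 - 2 * (n : ℤ))) ^ m =
      Q ^ (-(n : ℤ) ^ 2) * Q ^ (((m : ℤ) - n) ^ 2) := by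
    rw [h2, ← zpow_natCast Q, ← zpow_natCast _ m, ← zpow_mul, ← zpow_add₀ hQ, ← zpow_add₀ hQ,
      Nat.cast_sub (Nat.le_mul_self m)]
    congr 1
    push_cast
    ring
  have hwn : w ^ n * (w ^ m / w ^ n) = w ^ m := by field_simp
  linear_combination
    qFactorial (Q ^ 2) (n + n) / (qFactorial (Q ^ 2) m * qFactorial (Q ^ 2) (n + n - m)) *
      (w ^ m * h3 - Q ^ (-(n : ℤ) ^ 2) * Q ^ (((m : ℤ) - n) ^ 2) * hwn)

/-! ### Passage to the infinite triple product -/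

theorem summable_norm_mul_pow {Q : ℂ} (hQ : ‖Q‖ < 1) (w : ℂ) :
    Summable fun n : ℕ => ‖w * Q ^ (2 * n + 1)‖ := by
  have h : (fun n : ℕ => ‖w * Q ^ (2 * n + 1)‖) = fun n : ℕ => ‖w * Q‖ * (‖Q‖ ^ 2) ^ n := by
    funext n
    rw [norm_mul, norm_mul, norm_pow]
    ring
  rw [h]
  exact (summable_geometric_of_lt_one (by positivity)
    (pow_lt_one₀ (norm_nonneg _) hQ (by omega))).mul_left _

theorem summable_norm_neg_pow {q : ℂ} (hq : ‖q‖ < 1) :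
    Summable fun n : ℕ => ‖-q ^ (n + 1)‖ := by
  have h : (fun n : ℕ => ‖-q ^ (n + 1)‖) = fun n : ℕ => ‖q‖ * ‖q‖ ^ n := by
    funext n
    rw [norm_neg, norm_pow]
    ring
  rw [h]
  exact (summable_geometric_of_lt_one (norm_nonneg _) hq).mul_left _

theorem tendsto_qFactorial {q : ℂ} (hq : ‖q‖ < 1) :
    Tendsto (qFactorial q) atTop (𝓝 (∏' n : ℕ, (1 - q ^ (n + 1)))) := by
  have h := (multipliable_one_add_of_summable (summable_norm_neg_pow hq)).hasProd.tendsto_prod_nat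
  simp only [← sub_eq_add_neg] at h
  exact h

theorem tprod_one_sub_pow_ne_zero {q : ℂ} (hq : ‖q‖ < 1) :
    ∏' n : ℕ, (1 - q ^ (n + 1)) ≠ 0 := by
  have h := tprod_one_add_ne_zero_of_summable (f := fun n : ℕ => -q ^ (n + 1)) (fun n h => ?_)
    (summable_norm_neg_pow hq)
  · simpa only [← sub_eq_add_neg] using h
  · have h1 : ‖q ^ (n + 1)‖ < 1 := by
      rw [norm_pow]; exact pow_lt_one₀ (norm_nonneg _) hq (by omega)
    rw [show q ^ (n + 1) = 1 by linear_combination -h] at h1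
    simp at h1

theorem jacobiTheta₂_term_eq (j : ℤ) (z τ : ℂ) :
    jacobiTheta₂_term j z τ =
      cexp (2 * Real.pi * I * z) ^ j * cexp (Real.pi * I * τ) ^ (j ^ 2) := by
  rw [jacobiTheta₂_term, ← Complex.exp_int_mul, ← Complex.exp_int_mul, ← Complex.exp_add]
  congr 1
  push_cast
  ring

theorem norm_cexp_pi_mul_I_lt_one {τ : ℂ} (hτ : 0 < τ.im) : ‖cexp (Real.pi * I * τ)‖ < 1 := by
  rw [Complex.norm_exp, Real.exp_lt_one_iff]
  have := Real.pi_pos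
  simp
  positivity

/-- **Jacobi triple product**. -/
theorem jacobiTheta₂_eq_tprod (z : ℂ) {τ : ℂ} (hτ : 0 < τ.im) :
    jacobiTheta₂ z τ = (∏' n : ℕ, (1 - (cexp (Real.pi * I * τ) ^ 2) ^ (n + 1))) *
      ((∏' n : ℕ, (1 + cexp (2 * Real.pi * I * z) * cexp (Real.pi * I * τ) ^ (2 * n + 1))) *
      ∏' n : ℕ, (1 + (cexp (2 * Real.pi * I * z))⁻¹ * cexp (Real.pi * I * τ) ^ (2 * n + 1))) := by
  set w := cexp (2 * Real.pi * I * z) with hw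
  set Q := cexp (Real.pi * I * τ) with hQ
  have hw0 : w ≠ 0 := Complex.exp_ne_zero _
  have hQ0 : Q ≠ 0 := Complex.exp_ne_zero _
  have hQ1 : ‖Q‖ < 1 := norm_cexp_pi_mul_I_lt_one hτ
  have hq : ‖Q ^ 2‖ < 1 := by rw [norm_pow]; exact pow_lt_one₀ (norm_nonneg _) hQ1 (by omega)
  set P := ∏' n : ℕ, (1 - (Q ^ 2) ^ (n + 1))
  have hP : P ≠ 0 := tprod_one_sub_pow_ne_zero hq
  have hPt : Tendsto (qFactorial (Q ^ 2)) atTop (𝓝 P) := tendsto_qFactorial hq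
  have hPi : Tendsto (fun n => (qFactorial (Q ^ 2) n)⁻¹) atTop (𝓝 P⁻¹) := hPt.inv₀ hP
  obtain ⟨A, hA⟩ := (Metric.isBounded_range_of_tendsto _ hPt).exists_norm_le
  obtain ⟨B, hB⟩ := (Metric.isBounded_range_of_tendsto _ hPi).exists_norm_le
  have hA' : ∀ n, ‖qFactorial (Q ^ 2) n‖ ≤ A := fun n => hA _ ⟨n, rfl⟩
  have hB' : ∀ n, ‖(qFactorial (Q ^ 2) n)⁻¹‖ ≤ B := fun n => hB _ ⟨n, rfl⟩
  have hA0 : 0 ≤ A := (norm_nonneg _).trans (hA' 0)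
  have hB0 : 0 ≤ B := (norm_nonneg _).trans (hB' 0)
  -- Extending the coefficients by zero makes each finite identity a series over ℤ, ready for
  -- dominated convergence. For fixed `j` the coefficient tends to P · P⁻¹ · P⁻¹ = P⁻¹.
  let c : ℕ → ℤ → ℂ := fun n j => if j ∈ Finset.Icc (-(n : ℤ)) n then
    qFactorial (Q ^ 2) (n + n) *
      ((qFactorial (Q ^ 2) (n + j).toNat)⁻¹ * (qFactorial (Q ^ 2) (n - j).toNat)⁻¹) else 0
  have hfin : ∀ n : ℕ, ∑' j : ℤ, c n j * jacobiTheta₂_term j z τ =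
      ∏ i ∈ Finset.range n, ((1 + w * Q ^ (2 * i + 1)) * (1 + w⁻¹ * Q ^ (2 * i + 1))) := by
    intro n
    rw [prod_one_add_mul_one_add_inv hw0 hQ0 hQ1, tsum_eq_sum (s := Finset.Icc (-(n : ℤ)) n)
      (fun j hj => by simp only [c, if_neg hj, zero_mul])]
    refine Finset.sum_bij' (fun j _ => (n + j).toNat) (fun m _ => (m : ℤ) - n) ?_ ?_ ?_ ?_ ?_
    · intro j hj
      simp only [Finset.mem_Icc, Finset.mem_range] at *
      omega
    · intro m hm
      simp only [Finset.mem_Icc, Finset.mem_range] at *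
      omega
    · intro j hj
      simp only [Finset.mem_Icc] at *
      omega
    · intro m hm
      simp only [Finset.mem_range] at *
      omega
    · intro j hj
      simp only [c, if_pos hj]
      simp only [Finset.mem_Icc] at hj
      rw [jacobiTheta₂_term_eq, show n + n - (n + j).toNat = (n - j).toNat by omega,
        show (((n + j).toNat : ℕ) : ℤ) - n = j by omega, div_eq_mul_inv, mul_inv]
  have hlim : Tendsto (fun n : ℕ => ∑' j : ℤ, c n j * jacobiTheta₂_term j z τ) atTop
      (𝓝 (∑' j : ℤ, P⁻¹ * jacobiTheta₂_term j z τ)) := by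
    refine tendsto_tsum_of_dominated_convergence
      (bound := fun j => A * (B * B) * ‖jacobiTheta₂_term j z τ‖) ?_ ?_ ?_
    · exact (((summable_jacobiTheta₂_term_iff z τ).2 hτ).norm).mul_left _
    · intro j
      refine Tendsto.mul_const _ ?_
      have e1 : Tendsto (fun n : ℕ => n + n) atTop atTop :=
        tendsto_atTop_mono (fun n => Nat.le_add_left n n) tendsto_id
      have e2 : Tendsto (fun n : ℕ => ((n : ℤ) + j).toNat) atTop atTop :=
        tendsto_atTop.2 fun b => by
          filter_upwards [eventually_ge_atTop (b + j.natAbs)] with n hn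
          omega
      have e3 : Tendsto (fun n : ℕ => ((n : ℤ) - j).toNat) atTop atTop :=
        tendsto_atTop.2 fun b => by
          filter_upwards [eventually_ge_atTop (b + j.natAbs)] with n hn
          omega
      have h := (hPt.comp e1).mul ((hPi.comp e2).mul (hPi.comp e3))
      rw [mul_inv_cancel_left₀ hP] at h
      refine h.congr' ?_
      filter_upwards [eventually_ge_atTop j.natAbs] with n hn
      have : j ∈ Finset.Icc (-(n : ℤ)) n := by
        rw [Finset.mem_Icc]; omega
      simp only [c, if_pos this, Function.comp]
    · refine Eventually.of_forall fun n j => ?_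
      rw [norm_mul]
      refine mul_le_mul_of_nonneg_right ?_ (norm_nonneg _)
      simp only [c]
      split_ifs
      · rw [norm_mul, norm_mul]
        have := hA' (n + n)
        have := hB' (n + j).toNat
        have := hB' (n - j).toNat
        gcongr
      · rw [norm_zero]
        positivity
  have hprod : Tendsto (fun n : ℕ => ∑' j : ℤ, c n j * jacobiTheta₂_term j z τ) atTop
      (𝓝 ((∏' n : ℕ, (1 + w * Q ^ (2 * n + 1))) * ∏' n : ℕ, (1 + w⁻¹ * Q ^ (2 * n + 1)))) := by
    simp only [hfin, Finset.prod_mul_distrib]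
    exact (multipliable_one_add_of_summable
      (summable_norm_mul_pow hQ1 w)).hasProd.tendsto_prod_nat.mul
      (multipliable_one_add_of_summable (summable_norm_mul_pow hQ1 w⁻¹)).hasProd.tendsto_prod_nat
  rw [← tendsto_nhds_unique hlim hprod, tsum_mul_left, ← jacobiTheta₂, mul_inv_cancel_left₀ hP]

/-! ### Addition formula for theta functions -/

/-- The lattice `ℤ × ℤ` is the disjoint union of the pairs `(a + b, a - b)` and the pairs
`(a + b + 1, a - b)`. -/
theorem hasSum_int_prod_of_parity {f : ℤ × ℤ → ℂ} {s t : ℂ}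
    (hs : HasSum (fun p : ℤ × ℤ => f (p.1 + p.2, p.1 - p.2)) s)
    (ht : HasSum (fun p : ℤ × ℤ => f (p.1 + p.2 + 1, p.1 - p.2)) t) : HasSum f (s + t) := by
  set g₀ : ℤ × ℤ → ℤ × ℤ := fun p => (p.1 + p.2, p.1 - p.2) with h₀
  set g₁ : ℤ × ℤ → ℤ × ℤ := fun p => (p.1 + p.2 + 1, p.1 - p.2) with h₁
  have hg₀ : Function.Injective g₀ := by
    rintro ⟨a, b⟩ ⟨c, d⟩ h
    simp only [h₀, Prod.mk.injEq] at h ⊢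
    omega
  have hg₁ : Function.Injective g₁ := by
    rintro ⟨a, b⟩ ⟨c, d⟩ h
    simp only [h₁, Prod.mk.injEq] at h ⊢
    omega
  have hc : IsCompl (Set.range g₀) (Set.range g₁) := by
    rw [isCompl_iff, Set.disjoint_iff_forall_ne, codisjoint_iff_le_sup]
    refine ⟨?_, ?_⟩
    · rintro _ ⟨⟨a, b⟩, rfl⟩ _ ⟨⟨c, d⟩, rfl⟩ h
      simp only [h₀, h₁, Prod.mk.injEq] at h
      omega
    · rintro ⟨m, n⟩ -
      obtain h | h := Int.emod_two_eq_zero_or_one (m + n)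
      · refine Or.inl ⟨((m + n) / 2, (m - n) / 2), ?_⟩
        simp only [h₀, Prod.mk.injEq]
        omega
      · refine Or.inr ⟨((m + n) / 2, (m - n) / 2), ?_⟩
        simp only [h₁, Prod.mk.injEq]
        omega
  exact HasSum.add_isCompl hc (hg₀.hasSum_range_iff.2 hs) (hg₁.hasSum_range_iff.2 ht)

theorem hasSum_jacobiTheta₂_term_mul (u v : ℂ) {τ : ℂ} (hτ : 0 < τ.im) :
    HasSum (fun p : ℤ × ℤ => jacobiTheta₂_term p.1 u τ * jacobiTheta₂_term p.2 v τ)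
      (jacobiTheta₂ u τ * jacobiTheta₂ v τ) := by
  have h : ∀ f g : ℤ → ℂ, ∀ s t : ℂ, HasSum f s → HasSum g t →
      HasSum (fun p : ℤ × ℤ => f p.1 * g p.2) (s * t) := fun f g s t hf hg =>
    hf.mul hg (summable_mul_of_summable_norm hf.summable.norm hg.summable.norm)
  exact h (fun n => jacobiTheta₂_term n u τ) (fun n => jacobiTheta₂_term n v τ) _ _
    (hasSum_jacobiTheta₂_term u hτ) (hasSum_jacobiTheta₂_term v hτ)

/-- Addition formula for the product of two theta values with the same period. -/
theorem jacobiTheta₂_mul_jacobiTheta₂ (x y : ℂ) {τ : ℂ} (hτ : 0 < τ.im) :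
    jacobiTheta₂ x τ * jacobiTheta₂ y τ =
      jacobiTheta₂ (x + y) (2 * τ) * jacobiTheta₂ (x - y) (2 * τ) +
        cexp (2 * Real.pi * I * x) * cexp (Real.pi * I * τ) *
          (jacobiTheta₂ (x + y + τ) (2 * τ) * jacobiTheta₂ (x - y + τ) (2 * τ)) := by
  have hτ2 : 0 < (2 * τ).im := by simpa using hτ
  -- The substitution m = a + b, n = a - b gives m² + n² = 2(a² + b²), hence the period 2τ. In the
  -- odd class the extra terms 2a + 2b + 1 account for the shifts by τ and the prefactor.
  refine (hasSum_jacobiTheta₂_term_mul x y hτ).unique (hasSum_int_prod_of_parity ?_ ?_)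
  · refine Eq.mp (congrArg (HasSum · _) (funext fun p => ?_))
      (hasSum_jacobiTheta₂_term_mul (x + y) (x - y) hτ2)
    simp only [jacobiTheta₂_term, ← Complex.exp_add]
    congr 1
    push_cast
    ring
  · refine Eq.mp (congrArg (HasSum · _) (funext fun p => ?_))
      ((hasSum_jacobiTheta₂_term_mul (x + y + τ) (x - y + τ) hτ2).mul_left
        (cexp (2 * Real.pi * I * x) * cexp (Real.pi * I * τ)))
    simp only [jacobiTheta₂_term, ← Complex.exp_add]
    congr 1
    push_cast
    ring

/-! ### Theta constants, duplication and Jacobi's identity -/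

/-- The theta constant `θ₂(τ) = ∑ exp (π i (n + 1/2) ^ 2 τ)`. -/
noncomputable def thetaTwo (τ : ℂ) : ℂ := cexp (Real.pi * I * τ / 4) * jacobiTheta₂ (τ / 2) τ

/-- The theta constant `θ₃(τ) = ∑ exp (π i n ^ 2 τ)`. -/
noncomputable def thetaThree (τ : ℂ) : ℂ := jacobiTheta₂ 0 τ

/-- The theta constant `θ₄(τ) = ∑ (-1) ^ n exp (π i n ^ 2 τ)`. -/
noncomputable def thetaFour (τ : ℂ) : ℂ := jacobiTheta₂ (1 / 2) τ

theorem cexp_quarter_sq (τ : ℂ) :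
    cexp (Real.pi * I * (2 * τ) / 4) ^ 2 = cexp (Real.pi * I * τ) := by
  rw [← Complex.exp_nat_mul]
  congr 1
  push_cast
  ring

theorem thetaTwo_two_mul_sq (τ : ℂ) :
    thetaTwo (2 * τ) ^ 2 = cexp (Real.pi * I * τ) * jacobiTheta₂ τ (2 * τ) ^ 2 := by
  rw [thetaTwo, mul_pow, cexp_quarter_sq, mul_div_cancel_left₀ τ two_ne_zero]

theorem thetaThree_sq {τ : ℂ} (hτ : 0 < τ.im) :
    thetaThree τ ^ 2 = thetaThree (2 * τ) ^ 2 + thetaTwo (2 * τ) ^ 2 := by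
  have h := jacobiTheta₂_mul_jacobiTheta₂ 0 0 hτ
  rw [thetaTwo_two_mul_sq, thetaThree, thetaThree]
  simp only [add_zero, sub_zero, zero_add, mul_zero, Complex.exp_zero] at h
  linear_combination h

theorem thetaFour_sq {τ : ℂ} (hτ : 0 < τ.im) :
    thetaFour τ ^ 2 = thetaThree (2 * τ) ^ 2 - thetaTwo (2 * τ) ^ 2 := by
  have h := jacobiTheta₂_mul_jacobiTheta₂ (1 / 2) (1 / 2) hτ
  have h1 : jacobiTheta₂ 1 (2 * τ) = jacobiTheta₂ 0 (2 * τ) := by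
    rw [← jacobiTheta₂_add_left 0, zero_add]
  have h2 : cexp (2 * Real.pi * I * (1 / 2)) = -1 := by
    rw [← Complex.exp_pi_mul_I]
    congr 1
    ring
  rw [h2, sub_self, zero_add, add_halves, add_comm 1 τ, jacobiTheta₂_add_left, h1] at h
  rw [thetaTwo_two_mul_sq, thetaThree, thetaFour]
  linear_combination h

/-- In the addition formula at x = y = τ/2, quasi-periodicity makes the two summands equal, whence
the factor 2. -/
theorem thetaTwo_sq {τ : ℂ} (hτ : 0 < τ.im) :
    thetaTwo τ ^ 2 = 2 * thetaTwo (2 * τ) * thetaThree (2 * τ) := by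
  have h := jacobiTheta₂_mul_jacobiTheta₂ (τ / 2) (τ / 2) hτ
  have h1 := jacobiTheta₂_add_left' 0 (2 * τ)
  have h2 : cexp (2 * Real.pi * I * (τ / 2)) * cexp (Real.pi * I * τ) *
      cexp (-Real.pi * I * (2 * τ + 2 * 0)) = 1 := by
    rw [← Complex.exp_add, ← Complex.exp_add, Complex.exp_eq_one_iff]
    exact ⟨0, by push_cast; ring⟩
  have h3 : cexp (Real.pi * I * τ / 4) ^ 2 = cexp (Real.pi * I * (2 * τ) / 4) := by
    rw [← Complex.exp_nat_mul]
    congr 1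
    push_cast
    ring
  rw [sub_self, zero_add, add_halves, ← two_mul τ] at h
  rw [zero_add] at h1
  rw [h1] at h
  rw [thetaTwo, mul_pow, h3, thetaTwo, mul_div_cancel_left₀ τ two_ne_zero, thetaThree]
  linear_combination cexp (Real.pi * I * (2 * τ) / 4) *
    (h + jacobiTheta₂ 0 (2 * τ) * jacobiTheta₂ τ (2 * τ) * h2)

/-- Jacobi's identity `θ₃⁴ = θ₂⁴ + θ₄⁴`. -/
theorem thetaThree_pow_four {τ : ℂ} (hτ : 0 < τ.im) :
    thetaThree τ ^ 4 = thetaTwo τ ^ 4 + thetaFour τ ^ 4 := by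
  have h2 := thetaTwo_sq hτ
  have h3 := thetaThree_sq hτ
  have h4 := thetaFour_sq hτ
  -- After duplication this is (A + B)² = 4AB + (A - B)², with A and B the squares of θ₃ and θ₂ at
  -- 2τ.
  rw [show thetaThree τ ^ 4 = (thetaThree τ ^ 2) ^ 2 by ring,
    show thetaTwo τ ^ 4 = (thetaTwo τ ^ 2) ^ 2 by ring,
    show thetaFour τ ^ 4 = (thetaFour τ ^ 2) ^ 2 by ring, h2, h3, h4]
  ring

/-! ### Translation, inversion and nonvanishing -/

/-- Since n² - n is even, exp(πi n²) = exp(πi n). -/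
theorem jacobiTheta₂_add_one_right (z τ : ℂ) :
    jacobiTheta₂ z (τ + 1) = jacobiTheta₂ (z + 1 / 2) τ := by
  refine tsum_congr fun n => ?_
  rw [jacobiTheta₂_term, jacobiTheta₂_term, Complex.exp_eq_exp_iff_exists_int]
  obtain ⟨k, hk⟩ := (Int.even_mul_pred_self n).two_dvd
  refine ⟨k, ?_⟩
  have hk' : (n : ℂ) * (n - 1) = 2 * k := by exact_mod_cast hk
  linear_combination Real.pi * I * hk'

theorem thetaThree_add_one (τ : ℂ) : thetaThree (τ + 1) = thetaFour τ := by
  rw [thetaThree, jacobiTheta₂_add_one_right, zero_add, thetaFour]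

theorem thetaTwo_add_one_sq (τ : ℂ) : thetaTwo (τ + 1) ^ 2 = I * thetaTwo τ ^ 2 := by
  have h : cexp (Real.pi * I * (τ + 1) / 4) ^ 2 = I * cexp (Real.pi * I * τ / 4) ^ 2 := by
    rw [← Complex.exp_nat_mul, ← Complex.exp_nat_mul,
      show ((2 : ℕ) : ℂ) * (Real.pi * I * (τ + 1) / 4) =
        Real.pi / 2 * I + (2 : ℕ) * (Real.pi * I * τ / 4) by push_cast; ring,
      Complex.exp_add, Complex.exp_pi_div_two_mul_I]
  rw [thetaTwo, thetaTwo, jacobiTheta₂_add_one_right, mul_pow, mul_pow, h,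
    show (τ + 1) / 2 + 1 / 2 = τ / 2 + 1 by ring, jacobiTheta₂_add_left]
  ring

theorem thetaThree_eq_smul (τ : ℂ) :
    thetaThree τ = 1 / (-I * τ) ^ (1 / 2 : ℂ) * thetaThree (-1 / τ) := by
  rw [thetaThree, jacobiTheta₂_functional_equation]
  simp [thetaThree]

/-- Inversion carries z = τ/2 to 1/2, and its Gaussian factor cancels the prefactor of θ₂. -/
theorem thetaTwo_eq_smul {τ : ℂ} (hτ : τ ≠ 0) :
    thetaTwo τ = 1 / (-I * τ) ^ (1 / 2 : ℂ) * thetaFour (-1 / τ) := by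
  have h : cexp (Real.pi * I * τ / 4) * cexp (-Real.pi * I * (τ / 2) ^ 2 / τ) = 1 := by
    rw [← Complex.exp_add, Complex.exp_eq_one_iff]
    exact ⟨0, by field_simp; push_cast; ring⟩
  rw [thetaTwo, jacobiTheta₂_functional_equation, thetaFour,
    show τ / 2 / τ = 1 / 2 by field_simp]
  linear_combination (1 / (-I * τ) ^ (1 / 2 : ℂ) * jacobiTheta₂ (1 / 2) (-1 / τ)) * h

theorem thetaThree_ne_zero {τ : ℂ} (hτ : 0 < τ.im) : thetaThree τ ≠ 0 := by
  have hQ := norm_cexp_pi_mul_I_lt_one hτ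
  have h : ∏' n : ℕ, (1 + 1 * cexp (Real.pi * I * τ) ^ (2 * n + 1)) ≠ 0 := by
    refine tprod_one_add_ne_zero_of_summable (fun n h => ?_) (summable_norm_mul_pow hQ 1)
    have h1 : ‖cexp (Real.pi * I * τ) ^ (2 * n + 1)‖ < 1 := by
      rw [norm_pow]; exact pow_lt_one₀ (norm_nonneg _) hQ (by omega)
    rw [show cexp (Real.pi * I * τ) ^ (2 * n + 1) = -1 by linear_combination h] at h1
    simp at h1
  rw [thetaThree, jacobiTheta₂_eq_tprod 0 hτ]
  simp only [mul_zero, Complex.exp_zero, inv_one]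
  refine mul_ne_zero (tprod_one_sub_pow_ne_zero ?_) (mul_ne_zero h h)
  rw [norm_pow]
  exact pow_lt_one₀ (norm_nonneg _) hQ (by omega)

/-! ### λ as a theta quotient and its transformations -/

/-- At z = τ/2 one product in the triple product starts at exponent 0. The resulting 2, raised to
the fourth power, is the constant 16 in λ. -/
theorem tprod_one_add_pow_two_mul {Q : ℂ} (h : Multipliable fun n : ℕ => 1 + Q ^ (2 * n + 2)) :
    ∏' n : ℕ, (1 + Q ^ (2 * n)) = 2 * ∏' n : ℕ, (1 + Q ^ (2 * n + 2)) := by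
  let f : ℕ → ℂ := fun n => 1 + Q ^ (2 * n)
  have hf : ∀ n, f (n + 1) = 1 + Q ^ (2 * n + 2) := fun n => by simp only [f, mul_add, mul_one]
  have h0 : f 0 = 2 := by simp only [f, mul_zero, pow_zero, one_add_one_eq_two]
  have key := tprod_eq_zero_mul' (f := f) (by simpa only [hf] using h)
  simpa only [hf, h0] using key

/-- The elliptic lambda function is `θ₂⁴ / θ₃⁴`. -/
theorem ellipticLambda_eq {τ : ℂ} (hτ : 0 < τ.im) :
    ellipticLambda τ = thetaTwo τ ^ 4 / thetaThree τ ^ 4 := by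
  have hQ := norm_cexp_pi_mul_I_lt_one hτ
  set Q := cexp (Real.pi * I * τ) with hQd
  have hQ0 : Q ≠ 0 := Complex.exp_ne_zero _
  have hT3 := thetaThree_ne_zero hτ
  have hpow : ∀ n : ℕ, qPow (n + 1) τ = Q ^ (2 * n + 2) := fun n => by
    rw [qPow, hQd, ← Complex.exp_nat_mul]
    congr 1
    push_cast
    ring
  have hpow' : ∀ n : ℕ, qPow (n + 1 - 1 / 2) τ = Q ^ (2 * n + 1) := fun n => by
    rw [qPow, hQd, ← Complex.exp_nat_mul]
    congr 1
    push_cast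
    ring
  have hsN : Summable fun n : ℕ => ‖Q ^ (2 * n + 2)‖ := by
    refine (summable_norm_mul_pow hQ Q).congr fun n => ?_
    congr 1
    ring
  have hN : Multipliable fun n : ℕ => 1 + Q ^ (2 * n + 2) := multipliable_one_add_of_summable hsN
  have hsD := summable_norm_mul_pow hQ 1
  simp only [one_mul] at hsD
  have hD : Multipliable fun n : ℕ => 1 + Q ^ (2 * n + 1) := multipliable_one_add_of_summable hsD
  set N := ∏' n : ℕ, (1 + Q ^ (2 * n + 2)) with hNd
  set D := ∏' n : ℕ, (1 + Q ^ (2 * n + 1)) with hDd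
  set P := ∏' n : ℕ, (1 - (Q ^ 2) ^ (n + 1)) with hPd
  have h3 : thetaThree τ = P * (D * D) := by
    rw [thetaThree, jacobiTheta₂_eq_tprod 0 hτ]
    simp only [mul_zero, Complex.exp_zero, inv_one, one_mul, ← hQd, ← hPd, ← hDd]
  have hD0 : D ≠ 0 := by
    rintro h
    simp [h3, h] at hT3
  have hP0 : P ≠ 0 := by
    rintro h
    simp [h3, h] at hT3
  have h2 : thetaTwo τ = 2 * cexp (Real.pi * I * τ / 4) * (P * (N * N)) := by
    have hw : cexp (2 * Real.pi * I * (τ / 2)) = Q := by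
      rw [hQd]
      congr 1
      ring
    have e1 : ∀ n : ℕ, 1 + Q * Q ^ (2 * n + 1) = 1 + Q ^ (2 * n + 2) := fun n => by ring
    have e2 : ∀ n : ℕ, 1 + Q⁻¹ * Q ^ (2 * n + 1) = 1 + Q ^ (2 * n) := fun n => by
      rw [pow_succ]
      field_simp
    have e3 : ∏' n : ℕ, (1 + Q ^ (2 * n)) = 2 * N := tprod_one_add_pow_two_mul hN
    rw [thetaTwo, jacobiTheta₂_eq_tprod _ hτ, hw, ← hQd]
    simp only [e1, e2, e3, ← hPd, ← hNd]
    ring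
  have hlam : ∏' n : ℕ, lambdaFactor (n + 1) τ = N ^ 8 / D ^ 8 := by
    have h := ((hN.hasProd.pow 8).div₀ (hD.hasProd.pow 8) (pow_ne_zero 8 hD0))
    refine Eq.trans (tprod_congr fun n => ?_) h.tprod_eq
    rw [lambdaFactor]
    push_cast
    rw [hpow, hpow']
  have hhalf : qPow (1 / 2) τ = Q := by
    rw [qPow, hQd]
    congr 1
    push_cast
    ring
  have hquart : cexp (Real.pi * I * τ / 4) ^ 4 = Q := by
    rw [← Complex.exp_nat_mul]
    congr 1
    push_cast
    ring
  rw [ellipticLambda, hlam, hhalf, h2, h3]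
  simp only [mul_pow, hquart]
  field_simp
  ring

theorem neg_one_div_im_pos {τ : ℂ} (hτ : 0 < τ.im) : 0 < (-1 / τ).im := by
  have hτ0 : τ ≠ 0 := by
    rintro rfl
    simp at hτ
  rw [neg_div, one_div, Complex.neg_im, Complex.inv_im, neg_div, neg_neg]
  exact div_pos hτ (Complex.normSq_pos.2 hτ0)

theorem thetaFour_ne_zero {τ : ℂ} (hτ : 0 < τ.im) : thetaFour τ ≠ 0 := by
  rw [← thetaThree_add_one]
  exact thetaThree_ne_zero (by simpa using hτ)

theorem neg_I_mul_cpow_ne_zero {τ : ℂ} (hτ : 0 < τ.im) : 1 / (-I * τ) ^ (1 / 2 : ℂ) ≠ 0 := by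
  have hτ0 : τ ≠ 0 := by
    rintro rfl
    simp at hτ
  refine one_div_ne_zero ?_
  rw [Ne, Complex.cpow_eq_zero_iff, not_and_or]
  exact Or.inl (mul_ne_zero (neg_ne_zero.2 I_ne_zero) hτ0)

theorem thetaTwo_ne_zero {τ : ℂ} (hτ : 0 < τ.im) : thetaTwo τ ≠ 0 := by
  have hτ0 : τ ≠ 0 := by
    rintro rfl
    simp at hτ
  rw [thetaTwo_eq_smul hτ0]
  exact mul_ne_zero (neg_I_mul_cpow_ne_zero hτ) (thetaFour_ne_zero (neg_one_div_im_pos hτ))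

theorem thetaTwo_div_thetaThree {τ : ℂ} (hτ : 0 < τ.im) :
    thetaTwo τ / thetaThree τ = thetaFour (-1 / τ) / thetaThree (-1 / τ) := by
  have hτ0 : τ ≠ 0 := by
    rintro rfl
    simp at hτ
  rw [thetaTwo_eq_smul hτ0, thetaThree_eq_smul]
  exact mul_div_mul_left _ _ (neg_I_mul_cpow_ne_zero hτ)

theorem ellipticLambda_add_one {τ : ℂ} (hτ : 0 < τ.im) :
    ellipticLambda (τ + 1) = -(thetaTwo τ ^ 4 / thetaFour τ ^ 4) := by
  rw [ellipticLambda_eq (by simpa using hτ), thetaThree_add_one,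
    show thetaTwo (τ + 1) ^ 4 = (thetaTwo (τ + 1) ^ 2) ^ 2 by ring, thetaTwo_add_one_sq,
    mul_pow, I_sq]
  ring

theorem ellipticLambda_neg_one_div_add_one {τ : ℂ} (hτ : 0 < τ.im) :
    ellipticLambda (-1 / τ + 1) = -(thetaFour τ ^ 4 / thetaTwo τ ^ 4) := by
  have hτ' := neg_one_div_im_pos hτ
  have hτ0 : τ ≠ 0 := by
    rintro rfl
    simp at hτ
  have h3 := thetaThree_pow_four hτ
  have h3' := thetaThree_pow_four hτ'
  have h2 := thetaTwo_ne_zero hτ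
  have h4' := thetaFour_ne_zero hτ'
  have hc := neg_I_mul_cpow_ne_zero hτ
  -- Jacobi's identity removes θ₂(-1/τ) and θ₄(τ); what remains is covered by the inversion formulas
  -- for θ₂ and θ₃.
  rw [ellipticLambda_add_one hτ', neg_inj, div_eq_div_iff (pow_ne_zero 4 h4') (pow_ne_zero 4 h2),
    show thetaTwo (-1 / τ) ^ 4 = thetaThree (-1 / τ) ^ 4 - thetaFour (-1 / τ) ^ 4 by
      rw [h3']; ring,
    show thetaFour τ ^ 4 = thetaThree τ ^ 4 - thetaTwo τ ^ 4 by rw [h3]; ring,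
    thetaThree_eq_smul τ, thetaTwo_eq_smul hτ0]
  ring

theorem ellipticLambda_moebius {τ : ℂ} (hτ : 0 < τ.im) :
    ellipticLambda ((τ - 1) / (τ + 1)) =
      1 / 2 + I * (1 / 4 * (thetaFour τ ^ 2 / thetaTwo τ ^ 2 - thetaTwo τ ^ 2 / thetaFour τ ^ 2)) := by
  have hw : 0 < ((τ + 1) / 2).im := by simpa using hτ
  have h1 : τ + 1 ≠ 0 := by
    intro h
    simp [h] at hw
  have e : (τ - 1) / (τ + 1) = -1 / ((τ + 1) / 2) + 1 := by
    field_simp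
    ring
  have h2 := thetaTwo_ne_zero hτ
  have h4 := thetaFour_ne_zero hτ
  have hT4 := thetaFour_sq hw
  have hT2 := thetaTwo_sq hw
  rw [mul_div_cancel₀ _ (two_ne_zero' ℂ)] at hT4 hT2
  have hb : thetaThree (τ + 1) ^ 2 = thetaFour τ ^ 2 := by rw [thetaThree_add_one]
  rw [hb, thetaTwo_add_one_sq] at hT4
  have hT2' : thetaTwo ((τ + 1) / 2) ^ 4 = 4 * I * thetaTwo τ ^ 2 * thetaFour τ ^ 2 := by
    rw [show thetaTwo ((τ + 1) / 2) ^ 4 = (thetaTwo ((τ + 1) / 2) ^ 2) ^ 2 by ring, hT2, mul_pow,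
      mul_pow, hb, thetaTwo_add_one_sq]
    ring
  -- The value is now -(θ₄² - iθ₂²)²/(4i θ₂²θ₄²) at τ; the cross term of the square yields 1/2.
  rw [e, ellipticLambda_neg_one_div_add_one hw, hT2',
    show thetaFour ((τ + 1) / 2) ^ 4 = (thetaFour ((τ + 1) / 2) ^ 2) ^ 2 by ring, hT4]
  have hI := I_ne_zero
  field_simp
  ring_nf
  simp only [I_sq]
  ring

/-! ### Real products and monotonicity on the imaginary axis -/

/-- The real product `∏ (1 + x r ^ (2 n + 1))`. -/
noncomputable def oddPowProd (x r : ℝ) : ℝ := ∏' n : ℕ, (1 + x * r ^ (2 * n + 1))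

theorem summable_norm_mul_odd_pow {r : ℝ} (h0 : 0 < r) (h1 : r < 1) (x : ℝ) :
    Summable fun n : ℕ => ‖x * r ^ (2 * n + 1)‖ := by
  have hr : ‖(r : ℂ)‖ < 1 := by rwa [Complex.norm_real, Real.norm_of_nonneg h0.le]
  refine (summable_norm_mul_pow hr (x : ℂ)).congr fun n => ?_
  rw [← Complex.ofReal_pow, ← Complex.ofReal_mul, Complex.norm_real]

theorem hasProd_oddPowProd {r : ℝ} (h0 : 0 < r) (h1 : r < 1) (x : ℝ) :
    HasProd (fun n : ℕ => 1 + x * r ^ (2 * n + 1)) (oddPowProd x r) :=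
  (multipliable_one_add_of_summable (summable_norm_mul_odd_pow h0 h1 x)).hasProd

theorem ofReal_oddPowProd {r : ℝ} (h0 : 0 < r) (h1 : r < 1) (x : ℝ) :
    (oddPowProd x r : ℂ) = ∏' n : ℕ, (1 + (x : ℂ) * (r : ℂ) ^ (2 * n + 1)) := by
  have h := (hasProd_oddPowProd h0 h1 x).map Complex.ofRealHom Complex.continuous_ofReal
  refine h.tprod_eq.symm.trans (tprod_congr fun n => ?_)
  simp

theorem one_add_mul_odd_pow_pos {x r : ℝ} (hx : -1 ≤ x) (h0 : 0 < r) (h1 : r < 1) (n : ℕ) :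
    0 < 1 + x * r ^ (2 * n + 1) := by
  have h2 : r ^ (2 * n + 1) < 1 := pow_lt_one₀ h0.le h1 (by omega)
  have h3 : 0 < r ^ (2 * n + 1) := by positivity
  nlinarith

theorem oddPowProd_pos {x r : ℝ} (hx : -1 ≤ x) (h0 : 0 < r) (h1 : r < 1) : 0 < oddPowProd x r := by
  refine lt_of_le_of_ne ?_ (Ne.symm ?_)
  · exact ge_of_tendsto' (hasProd_oddPowProd h0 h1 x).tendsto_prod_nat fun n =>
      Finset.prod_nonneg fun i _ => (one_add_mul_odd_pow_pos hx h0 h1 i).le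
  · exact tprod_one_add_ne_zero_of_summable
      (fun n => (one_add_mul_odd_pow_pos hx h0 h1 n).ne') (summable_norm_mul_odd_pow h0 h1 x)

theorem oddPowProd_one_le {r s : ℝ} (h0 : 0 < r) (hrs : r ≤ s) (h1 : s < 1) :
    oddPowProd 1 r ≤ oddPowProd 1 s := by
  refine le_of_tendsto_of_tendsto' (hasProd_oddPowProd h0 (hrs.trans_lt h1) 1).tendsto_prod_nat
    (hasProd_oddPowProd (h0.trans_le hrs) h1 1).tendsto_prod_nat fun n => ?_
  refine Finset.prod_le_prod (fun i _ =>
    (one_add_mul_odd_pow_pos (by norm_num) h0 (hrs.trans_lt h1) i).le) fun i _ => ?_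
  gcongr

/-- Limits preserve only weak inequalities, so the first factor is split off: its ratio (1 - s)/(1 -
r) < 1 supplies the strictness. -/
theorem oddPowProd_neg_one_lt {r s : ℝ} (h0 : 0 < r) (hrs : r < s) (h1 : s < 1) :
    oddPowProd (-1) s < oddPowProd (-1) r := by
  have hr1 := hrs.trans h1
  have hs0 := h0.trans hrs
  have hpos := oddPowProd_pos (x := -1) le_rfl h0 hr1
  have hle : oddPowProd (-1) s ≤ (1 - s) / (1 - r) * oddPowProd (-1) r := by
    refine le_of_tendsto_of_tendsto'
      ((tendsto_add_atTop_iff_nat 1).2 (hasProd_oddPowProd hs0 h1 (-1)).tendsto_prod_nat)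
      (((tendsto_add_atTop_iff_nat 1).2
        (hasProd_oddPowProd h0 hr1 (-1)).tendsto_prod_nat).const_mul _) fun n => ?_
    rw [Finset.prod_range_succ', Finset.prod_range_succ']
    have h : ∏ k ∈ Finset.range n, (1 + -1 * s ^ (2 * (k + 1) + 1)) ≤
        ∏ k ∈ Finset.range n, (1 + -1 * r ^ (2 * (k + 1) + 1)) := by
      refine Finset.prod_le_prod (fun i _ =>
        (one_add_mul_odd_pow_pos le_rfl hs0 h1 (i + 1)).le) fun i _ => ?_
      have : r ^ (2 * (i + 1) + 1) ≤ s ^ (2 * (i + 1) + 1) := by gcongr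
      linarith
    have hr : 1 - r ≠ 0 := by linarith
    have e : (1 - s) / (1 - r) *
        ((∏ k ∈ Finset.range n, (1 + -1 * r ^ (2 * (k + 1) + 1))) * (1 + -1 * r ^ (2 * 0 + 1))) =
        (∏ k ∈ Finset.range n, (1 + -1 * r ^ (2 * (k + 1) + 1))) * (1 - s) := by
      rw [show 1 + -1 * r ^ (2 * 0 + 1) = 1 - r by ring]
      field_simp
    rw [e, show 1 + -1 * s ^ (2 * 0 + 1) = 1 - s by ring]
    exact mul_le_mul_of_nonneg_right h (by linarith)
  refine hle.trans_lt ?_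
  have : (1 - s) / (1 - r) < 1 := by
    rw [div_lt_one (by linarith)]
    linarith
  nlinarith

/-- The complementary modulus `θ₄² / θ₃²` at `√(-d)`, as a real number. -/
noncomputable def complementaryModulus (d : ℝ) : ℝ :=
  (oddPowProd (-1) (Real.exp (-(Real.pi * √d))) / oddPowProd 1 (Real.exp (-(Real.pi * √d)))) ^ 4

theorem exp_neg_pi_mul_sqrt_lt_one {d : ℝ} (hd : 0 < d) : Real.exp (-(Real.pi * √d)) < 1 := by
  rw [Real.exp_lt_one_iff, neg_lt_zero]
  have := Real.sqrt_pos.2 hd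
  have := Real.pi_pos
  positivity

theorem complementaryModulus_pos {d : ℝ} (hd : 0 < d) : 0 < complementaryModulus d :=
  pow_pos (div_pos (oddPowProd_pos le_rfl (Real.exp_pos _) (exp_neg_pi_mul_sqrt_lt_one hd))
    (oddPowProd_pos (by norm_num) (Real.exp_pos _) (exp_neg_pi_mul_sqrt_lt_one hd))) 4

theorem complementaryModulus_lt {c d : ℝ} (hc : 0 < c) (hcd : c < d) :
    complementaryModulus c < complementaryModulus d := by
  have hd := hc.trans hcd
  have hlt : Real.exp (-(Real.pi * √d)) < Real.exp (-(Real.pi * √c)) := by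
    rw [Real.exp_lt_exp, neg_lt_neg_iff]
    exact mul_lt_mul_of_pos_left (Real.sqrt_lt_sqrt hc.le hcd) Real.pi_pos
  have h1 := exp_neg_pi_mul_sqrt_lt_one hc
  have p1 := oddPowProd_pos (x := 1) (by norm_num) (Real.exp_pos _)
    (exp_neg_pi_mul_sqrt_lt_one hd)
  have p2 := oddPowProd_pos (x := -1) le_rfl (Real.exp_pos _) h1
  have p3 := oddPowProd_pos (x := 1) (by norm_num) (Real.exp_pos _) h1
  refine pow_lt_pow_left₀ ?_ (div_pos p2 p3).le (by norm_num)
  exact div_lt_div₀ (oddPowProd_neg_one_lt (Real.exp_pos _) hlt h1)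
    (oddPowProd_one_le (Real.exp_pos _) hlt.le h1)
    (oddPowProd_pos le_rfl (Real.exp_pos _) (exp_neg_pi_mul_sqrt_lt_one hd)).le p1

/-- At z = 0 and z = 1/2 the triple product has w = w⁻¹ = ±1, so each theta constant is a common
factor times the square of a real product. -/
theorem thetaFour_sq_div_thetaThree_sq {d : ℝ} (hd : 0 < d) :
    thetaFour (sqrtNeg d) ^ 2 / thetaThree (sqrtNeg d) ^ 2 = (complementaryModulus d : ℂ) := by
  have him := sqrtNeg_im_pos hd
  have h1 := exp_neg_pi_mul_sqrt_lt_one hd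
  have hT3 := thetaThree_ne_zero him
  have hQ : cexp (Real.pi * I * sqrtNeg d) = (Real.exp (-(Real.pi * √d)) : ℝ) := by
    rw [Complex.ofReal_exp, sqrtNeg]
    congr 1
    push_cast
    linear_combination Real.pi * (√d : ℂ) * I_sq
  have hw : cexp (2 * Real.pi * I * (1 / 2)) = -1 := by
    rw [← Complex.exp_pi_mul_I]
    congr 1
    ring
  have h3 := jacobiTheta₂_eq_tprod 0 him
  have h4 := jacobiTheta₂_eq_tprod (1 / 2) him
  have o1 := ofReal_oddPowProd (Real.exp_pos _) h1 1
  have o2 := ofReal_oddPowProd (Real.exp_pos _) h1 (-1)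
  rw [Complex.ofReal_neg, Complex.ofReal_one] at o2
  rw [Complex.ofReal_one] at o1
  rw [hQ, mul_zero, Complex.exp_zero, inv_one, ← o1, ← thetaThree] at h3
  rw [hw, hQ, inv_neg, inv_one, ← o2, ← thetaFour] at h4
  rw [h3] at hT3
  have hP := left_ne_zero_of_mul hT3
  have hG := left_ne_zero_of_mul (right_ne_zero_of_mul hT3)
  rw [h3, h4, complementaryModulus]
  push_cast at hP hG ⊢
  field_simp

theorem thetaTwo_sq_div_thetaThree_sq {d : ℝ} (hd : 0 < d) :
    thetaTwo (sqrtNeg d) ^ 2 / thetaThree (sqrtNeg d) ^ 2 = (complementaryModulus (1 / d) : ℂ) := by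
  have e : -1 / sqrtNeg d = sqrtNeg (1 / d) := by
    have hs : ((√d : ℝ) : ℂ) ≠ 0 := by exact_mod_cast (Real.sqrt_pos.2 hd).ne'
    rw [sqrtNeg, sqrtNeg, Real.sqrt_div zero_le_one, Real.sqrt_one]
    push_cast
    have hI := I_ne_zero
    field_simp
    rw [I_sq]
  rw [← div_pow, thetaTwo_div_thetaThree (sqrtNeg_im_pos hd), e, div_pow,
    thetaFour_sq_div_thetaThree_sq (one_div_pos.2 hd)]

theorem ellipticLambda_sqrtNeg {d : ℝ} (hd : 0 < d) :
    ellipticLambda (sqrtNeg d) = ((complementaryModulus (1 / d) ^ 2 : ℝ) : ℂ) := by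
  rw [Complex.ofReal_pow, ← thetaTwo_sq_div_thetaThree_sq hd, ellipticLambda_eq (sqrtNeg_im_pos hd)]
  ring

theorem complementaryModulus_sq_add {d : ℝ} (hd : 0 < d) :
    complementaryModulus (1 / d) ^ 2 + complementaryModulus d ^ 2 = 1 := by
  have h3 := thetaThree_ne_zero (sqrtNeg_im_pos hd)
  rw [← Complex.ofReal_inj]
  push_cast
  rw [← thetaTwo_sq_div_thetaThree_sq hd, ← thetaFour_sq_div_thetaThree_sq hd]
  field_simp
  exact (thetaThree_pow_four (sqrtNeg_im_pos hd)).symm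

/-- Settles the branch: the principal root of a positive real square is its positive root. -/
theorem sqrt_ofReal_sq_div_sq {a b : ℝ} (ha : 0 < a) (hb : 0 < b) :
    Complex.sqrt (((b ^ 2 : ℝ) : ℂ) / ((a ^ 2 : ℝ) : ℂ)) = ((b / a : ℝ) : ℂ) := by
  have h : ((b ^ 2 : ℝ) : ℂ) / ((a ^ 2 : ℝ) : ℂ) = (((b / a) ^ 2 : ℝ) : ℂ) := by
    push_cast
    ring
  rw [h, Complex.sqrt_of_nonneg (by exact_mod_cast sq_nonneg (b / a)), Complex.ofReal_re,
    Real.sqrt_sq (div_pos hb ha).le]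

theorem alpha_eq {d : ℝ} (hd : 0 < d) :
    alpha d = ((1 / 4 * (complementaryModulus d / complementaryModulus (1 / d) -
      complementaryModulus (1 / d) / complementaryModulus d) : ℝ) : ℂ) := by
  have ha := complementaryModulus_pos (one_div_pos.2 hd)
  have hb := complementaryModulus_pos hd
  have h1 : 1 - ellipticLambda (sqrtNeg d) = ((complementaryModulus d ^ 2 : ℝ) : ℂ) := by
    rw [ellipticLambda_sqrtNeg hd, ← Complex.ofReal_one, ← Complex.ofReal_sub,
      sub_eq_of_eq_add' (complementaryModulus_sq_add hd).symm]
  rw [alpha, h1, ellipticLambda_sqrtNeg hd, sqrt_ofReal_sq_div_sq ha hb,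
    sqrt_ofReal_sq_div_sq hb ha]
  push_cast
  ring

theorem lemma2 :
    (∀ c d : ℝ, 0 < c → c < d →
      (ellipticLambda (sqrtNeg d)).im = 0 ∧ (ellipticLambda (sqrtNeg c)).im = 0 ∧
      0 < (ellipticLambda (sqrtNeg d)).re ∧
      (ellipticLambda (sqrtNeg d)).re < (ellipticLambda (sqrtNeg c)).re ∧
      (ellipticLambda (sqrtNeg c)).re < 1) ∧
    (∀ d : ℝ, 0 < d → (alpha d).im = 0) ∧
    StrictMonoOn (fun d : ℝ => (alpha d).re) (Set.Ioi 0) ∧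
    (∀ d : ℝ, 0 < d →
      ellipticLambda ((sqrtNeg d - 1) / (sqrtNeg d + 1)) = 1 / 2 + Complex.I * alpha d) := by
  refine ⟨fun c d hc hcd => ?_, fun d hd => ?_, fun c hc d hd hcd => ?_, fun d hd => ?_⟩
  · have hd := hc.trans hcd
    rw [ellipticLambda_sqrtNeg hd, ellipticLambda_sqrtNeg hc]
    simp only [Complex.ofReal_re, Complex.ofReal_im, true_and]
    have h1 := complementaryModulus_pos (one_div_pos.2 hd)
    refine ⟨pow_pos h1 2, pow_lt_pow_left₀ (complementaryModulus_lt (one_div_pos.2 hd)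
      (one_div_lt_one_div_of_lt hc hcd)) h1.le two_ne_zero, ?_⟩
    have h2 := pow_pos (complementaryModulus_pos hc) 2
    linarith [complementaryModulus_sq_add hc]
  · rw [alpha_eq hd, Complex.ofReal_im]
  · have hc' : 0 < c := hc
    have hd' : 0 < d := hd
    simp only [alpha_eq hc', alpha_eq hd', Complex.ofReal_re]
    have hb := complementaryModulus_lt hc' hcd
    have ha := complementaryModulus_lt (one_div_pos.2 hd') (one_div_lt_one_div_of_lt hc' hcd)
    have pb := complementaryModulus_pos hc'
    have pa := complementaryModulus_pos (one_div_pos.2 hd')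
    -- As d grows, k'(d) increases and k'(1/d) decreases, so the first quotient in α rises and the
    -- subtracted one falls.
    have h1 := div_lt_div₀ hb ha.le (pb.trans hb).le pa
    have h2 := div_lt_div₀ ha hb.le (pa.trans ha).le pb
    linarith
  · have him := sqrtNeg_im_pos hd
    have h3 := thetaThree_ne_zero him
    rw [ellipticLambda_moebius him, alpha_eq hd]
    push_cast
    rw [← thetaTwo_sq_div_thetaThree_sq hd, ← thetaFour_sq_div_thetaThree_sq hd,
      div_div_div_cancel_right₀ (pow_ne_zero 2 h3), div_div_div_cancel_right₀ (pow_ne_zero 2 h3)]
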